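/- Let $X$ be a complex surface and let $w\in H^0(X,S^2\Omega^1_X)$ be a holomorphic symmetric 2-differential of rank 2, i.e. at the general point $x\in X$ (on a dense open subset) $w(x)$ is a product of two linearly independent linear forms on $T_xX$. Say that $w$ has a holomorphic closed decomposition at $x$ if $w=\mu_1\mu_2$ on some open neighbourhood of $x$, with $\mu_1,\mu_2$ closed holomorphic 1-forms there; that $w$ is closed if it has a holomorphic closed decomposition at the general point of $X$; and that $w$ is of the 1st kind on an open set $U\subseteq X$ if it has a holomorphic closed decomposition at every point of $U$. Let $B_w=\{x\in X \mid w \text{ has no holomorphic closed decomposition at } x\}$ be the breakdown locus. (1) If $w$ is closed, then $B_w$ has no isolated points. (2) Let $\mathbb B\subseteq X$ be a coordinate ball, i.e. the preimage under a holomorphic chart of an open ball in $\mathbb C^2$ contained in the image of the chart, and let $\mathbb B^*$ be $\mathbb B$ without its centre. If $w$ is of the 1st kind on $\mathbb B^*$, then $w$ is of the 1st kind on $\mathbb B$. -/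

import Mathlib

open scoped Manifold ContDiff Topology

noncomputable section

/-- The model space `ℂ²`, with its Hermitian norm. -/
abbrev C2 : Type := EuclideanSpace ℂ (Fin 2)

/-- The holomorphic charts of a complex surface `X`, i.e. the charts of its maximal holomorphic
atlas (over `ℂ`, class `C^ω` means holomorphic). -/
abbrev holomorphicCharts (X : Type*) [TopologicalSpace X] [ChartedSpace C2 X] :
    Set (OpenPartialHomeomorph X C2) :=
  IsManifold.maximalAtlas 𝓘(ℂ, C2) ω X

/-- A (not necessarily regular) field of `ℂ`-linear forms on the holomorphic tangent spaces. -/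
abbrev OneFormField (X : Type*) [TopologicalSpace X] [ChartedSpace C2 X] : Type _ :=
  ∀ x : X, TangentSpace 𝓘(ℂ, C2) x →L[ℂ] ℂ

/-- The expression of a field of linear forms in a chart `e`: its pullback under `e.symm`. -/
def OneFormField.inChart {X : Type*} [TopologicalSpace X] [ChartedSpace C2 X]
    (μ : OneFormField X) (e : OpenPartialHomeomorph X C2) (y : C2) : C2 →L[ℂ] ℂ :=
  (μ (e.symm y)).comp (mfderiv 𝓘(ℂ, C2) 𝓘(ℂ, C2) e.symm y)

/-- `μ` is a closed holomorphic 1-form on `U` (used for open `U`): in every holomorphic chart its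
expression `α` is holomorphic, and `dα(u, v) = (D_u α)(v) - (D_v α)(u)` vanishes. -/
structure OneFormField.IsClosedHolomorphicOn {X : Type*} [TopologicalSpace X] [ChartedSpace C2 X]
    (μ : OneFormField X) (U : Set X) : Prop where
  holomorphic : ∀ e ∈ holomorphicCharts X,
    DifferentiableOn ℂ (μ.inChart e) (e.target ∩ e.symm ⁻¹' U)
  closed : ∀ e ∈ holomorphicCharts X, ∀ y ∈ e.target ∩ e.symm ⁻¹' U, ∀ u v : C2,
    fderiv ℂ (μ.inChart e) y u v = fderiv ℂ (μ.inChart e) y v u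

/-- A holomorphic symmetric 2-differential `w ∈ H⁰(X, S²Ω¹_X)`: a field of quadratic forms on the
holomorphic tangent spaces (homogeneous polynomials of degree 2) which in every holomorphic chart
reads `a(z) dz₁² + b(z) dz₁ dz₂ + c(z) dz₂²` with holomorphic coefficients, i.e. whose value on each
constant vector `v` is a holomorphic function of `z`. -/
structure SymmetricTwoDifferential (X : Type*) [TopologicalSpace X] [ChartedSpace C2 X] where
  form : ∀ x : X, QuadraticForm ℂ (TangentSpace 𝓘(ℂ, C2) x)
  holomorphic : ∀ e ∈ holomorphicCharts X, ∀ v : C2,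
    DifferentiableOn ℂ
      (fun y : C2 => form (e.symm y) (mfderiv 𝓘(ℂ, C2) 𝓘(ℂ, C2) e.symm y v)) e.target

namespace SymmetricTwoDifferential

/-- A property holds at the general point of `X` if it holds on a dense open subset. -/
def AtGeneralPoint {X : Type*} [TopologicalSpace X] (P : X → Prop) : Prop :=
  ∃ U : Set X, IsOpen U ∧ Dense U ∧ ∀ x ∈ U, P x

variable {X : Type*} [TopologicalSpace X] [ChartedSpace C2 X]

/-- `w(x)` is a product of two linearly independent linear forms on `T_x X`, that is, its zero
locus consists of two distinct lines. -/
def DefinesTwoLinesAt (w : SymmetricTwoDifferential X) (x : X) : Prop :=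
  ∃ α β : TangentSpace 𝓘(ℂ, C2) x →ₗ[ℂ] ℂ,
    LinearIndependent ℂ ![α, β] ∧ w.form x = QuadraticMap.linMulLin α β

/-- `w` has rank 2: at the general point it defines two distinct lines. -/
def HasRankTwo (w : SymmetricTwoDifferential X) : Prop :=
  AtGeneralPoint w.DefinesTwoLinesAt

/-- `w = μ₁ μ₂` on `U`, with `μ₁`, `μ₂` closed holomorphic 1-forms on `U`. -/
def HasHolomorphicClosedDecompositionOn (w : SymmetricTwoDifferential X) (U : Set X) : Prop :=
  ∃ μ₁ μ₂ : OneFormField X, μ₁.IsClosedHolomorphicOn U ∧ μ₂.IsClosedHolomorphicOn U ∧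
    ∀ x ∈ U, w.form x = QuadraticMap.linMulLin (μ₁ x).toLinearMap (μ₂ x).toLinearMap

/-- `w` has a holomorphic closed decomposition at `x`, i.e. on some open neighbourhood of `x`. -/
def HasHolomorphicClosedDecompositionAt (w : SymmetricTwoDifferential X) (x : X) : Prop :=
  ∃ U : Set X, IsOpen U ∧ x ∈ U ∧ w.HasHolomorphicClosedDecompositionOn U

/-- `w` is closed: it has a holomorphic closed decomposition at the general point. -/
def Closed (w : SymmetricTwoDifferential X) : Prop :=
  AtGeneralPoint w.HasHolomorphicClosedDecompositionAt

/-- `w` is of the 1st kind on `U` (used for open `U`): it has a holomorphic closed decomposition at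
every point of `U`. -/
def IsOfFirstKindOn (w : SymmetricTwoDifferential X) (U : Set X) : Prop :=
  ∀ x ∈ U, w.HasHolomorphicClosedDecompositionAt x

/-- The breakdown locus `B_w`. -/
def breakdownLocus (w : SymmetricTwoDifferential X) : Set X :=
  {x | ¬ w.HasHolomorphicClosedDecompositionAt x}

end SymmetricTwoDifferential

end

/-! Both assertions reduce to one local fact: closed decompositions around every point of a
punctured ball in `ℂ²` produce one around the centre. An isolated point of the breakdown locus would
be the centre of such a ball.

The first ingredient is rigidity (`closedDecomp_unique`). Where `α β = α' β'` has rank two, after a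
possible swap `α' = f α` and `β' = f⁻¹ β`. Closedness gives `df ∧ α = df ∧ β = 0`, so `df = 0` and
`f` is constant. By the identity theorem this persists on a convex open set. Hence local
decompositions can be normalised to agree and glued, provided that there is no monodromy
(`hasClosedDecomp_iUnion`, `hasClosedDecomp_of_convex`).

The second ingredient is Hartogs extension. Around the centre, a Hartogs figure avoiding it is
covered by bidiscs: a family along the cylinder over a circle in the second coordinate, and one
slice over a full disc in that coordinate. Every overlap meets the slice, which kills the monodromy
and gives a single decomposition on the figure. A Cauchy integral in the second coordinate extends
both factors over the full bidisc, and the identity theorem carries closedness and the product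
formula along (`hasClosedDecomp_bidisc_of_hartogsFigure`). -/

/-! ### Cauchy integrals with parameters and the identity theorem. -/

section SeveralVariables

variable {E F : Type*} [NormedAddCommGroup E] [NormedSpace ℂ E] [NormedAddCommGroup F]
  [NormedSpace ℂ F]

/-- Cauchy estimate. The factor 2 appears because the Schwarz-type bound concerns `f z - f c`, of
norm at most `2 * M`. -/
theorem norm_fderiv_le_of_norm_le_on_ball {f : E → F} {c : E} {R M : ℝ} (hR : 0 < R)
    (hd : DifferentiableOn ℂ f (Metric.ball c R)) (hM : ∀ z ∈ Metric.ball c R, ‖f z‖ ≤ M) :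
    ‖fderiv ℂ f c‖ ≤ 2 * M / R := by
  refine Complex.norm_fderiv_le_div_of_mapsTo_ball hd (fun z hz => ?_) hR
  rw [mem_closedBall_iff_norm]
  have h1 := hM z hz
  have h2 := hM c (Metric.mem_ball_self hR)
  have h3 := norm_sub_le (f z) (f c)
  linarith

/-- By uniform continuity on a compact set, `H · θ` is uniformly close to `H · θ₀` near `z₀`; the
Cauchy estimate for the difference makes the derivatives close. This supplies measurability when
differentiating under the integral. -/
theorem continuous_fderiv_of_param [ProperSpace E] {H : E → ℝ → F} {U : Set E} (hU : IsOpen U)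
    (hc : ContinuousOn (Function.uncurry H) (U ×ˢ Set.univ))
    (hd : ∀ θ, DifferentiableOn ℂ (fun z => H z θ) U) {z₀ : E} (hz₀ : z₀ ∈ U) :
    Continuous fun θ => fderiv ℂ (fun z => H z θ) z₀ := by
  obtain ⟨δ, hδ, hδU⟩ := Metric.nhds_basis_closedBall.mem_iff.1 (hU.mem_nhds hz₀)
  have hbU : Metric.ball z₀ δ ⊆ U := Metric.ball_subset_closedBall.trans hδU
  rw [Metric.continuous_iff]
  intro θ₀ ε hε
  have hK : IsCompact (Metric.closedBall z₀ δ ×ˢ Metric.closedBall θ₀ 1) :=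
    (isCompact_closedBall _ _).prod (isCompact_closedBall _ _)
  have hcK : ContinuousOn (Function.uncurry H)
      (Metric.closedBall z₀ δ ×ˢ Metric.closedBall θ₀ 1) :=
    hc.mono (Set.prod_mono hδU (Set.subset_univ _))
  have huc := hK.uniformContinuousOn_of_continuous hcK
  rw [Metric.uniformContinuousOn_iff] at huc
  obtain ⟨η, hη, huc⟩ := huc (ε * δ / 4) (by positivity)
  refine ⟨min η 1, by positivity, fun θ hθ => ?_⟩
  have hzd : ∀ θ, DifferentiableAt ℂ (fun z => H z θ) z₀ := fun θ =>
    (hd θ).differentiableAt (hU.mem_nhds hz₀)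
  rw [dist_eq_norm, ← fderiv_fun_sub (hzd θ) (hzd θ₀)]
  have hb := norm_fderiv_le_of_norm_le_on_ball (f := fun z => H z θ - H z θ₀) (M := ε * δ / 4) hδ
    (((hd θ).sub (hd θ₀)).mono hbU) (fun z hz => by
      have hz' := Metric.ball_subset_closedBall hz
      have := huc (z, θ) ⟨hz', by
        simpa using (hθ.trans_le (min_le_right _ _)).le⟩ (z, θ₀) ⟨hz', by simp⟩ (by
          simpa [Prod.dist_eq, hη] using hθ.trans_le (min_le_left _ _))
      simpa [dist_eq_norm] using this.le)
  calc _ ≤ 2 * (ε * δ / 4) / δ := hb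
    _ = ε / 2 := by field_simp; norm_num
    _ < ε := by linarith

/-- An integral of holomorphic functions depending continuously on a real parameter is
holomorphic. -/
theorem differentiableOn_intervalIntegral_of_param [FiniteDimensional ℂ E] [CompleteSpace F]
    {H : E → ℝ → F} {U : Set E} (hU : IsOpen U)
    (hc : ContinuousOn (Function.uncurry H) (U ×ˢ Set.univ))
    (hd : ∀ θ, DifferentiableOn ℂ (fun z => H z θ) U) (a b : ℝ) :
    DifferentiableOn ℂ (fun z => ∫ θ in a..b, H z θ) U := by
  have : ProperSpace E := FiniteDimensional.proper ℂ E
  intro z₀ hz₀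
  obtain ⟨δ, hδ, hδU⟩ := Metric.nhds_basis_closedBall.mem_iff.1 (hU.mem_nhds hz₀)
  have hbU : Metric.ball z₀ δ ⊆ U := Metric.ball_subset_closedBall.trans hδU
  have hcont : ∀ z ∈ U, Continuous (H z) := fun z hz =>
    (hc.comp_continuous (f := fun θ : ℝ => (z, θ)) (by fun_prop) (fun θ => ⟨hz, trivial⟩))
  have hK : IsCompact (Metric.closedBall z₀ δ ×ˢ Set.uIcc a b) :=
    (isCompact_closedBall _ _).prod isCompact_uIcc
  obtain ⟨M, hM⟩ := hK.exists_bound_of_continuousOn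
    (hc.mono (Set.prod_mono hδU (Set.subset_univ _)))
  have key := intervalIntegral.hasFDerivAt_integral_of_dominated_of_fderiv_le (𝕜 := ℂ)
    (μ := MeasureTheory.volume) (F := H) (F' := fun z θ => fderiv ℂ (fun z => H z θ) z) (x₀ := z₀)
    (a := a) (b := b) (s := Metric.ball z₀ (δ / 2)) (bound := fun _ => 2 * M / (δ / 2))
    (Metric.ball_mem_nhds _ (by positivity))
    (by
      filter_upwards [hU.mem_nhds hz₀] with z hz
      exact (hcont z hz).aestronglyMeasurable)
    ((hcont z₀ hz₀).intervalIntegrable _ _)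
    (continuous_fderiv_of_param hU hc hd hz₀).aestronglyMeasurable
    (by
      refine Filter.Eventually.of_forall fun t ht z hz => ?_
      have hsub : Metric.ball z (δ / 2) ⊆ Metric.ball z₀ δ := by
        refine Metric.ball_subset_ball' ?_
        have := Metric.mem_ball.1 hz
        linarith
      exact norm_fderiv_le_of_norm_le_on_ball (by positivity)
        ((hd t).mono (hsub.trans hbU)) fun x hx =>
          hM (x, t) ⟨Metric.ball_subset_closedBall (hsub hx), Set.uIoc_subset_uIcc ht⟩)
    intervalIntegrable_const
    (by
      refine Filter.Eventually.of_forall fun t _ z hz => ?_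
      have hzU : z ∈ U := hbU (Metric.ball_subset_ball (by linarith) hz)
      exact ((hd t).differentiableAt (hU.mem_nhds hzU)).hasFDerivAt)
  exact key.differentiableAt.differentiableWithinAt

theorem differentiableOn_circleIntegral_of_param [FiniteDimensional ℂ E] [CompleteSpace F]
    {G : E → ℂ → F} {U : Set E} (hU : IsOpen U) {c : ℂ} {R : ℝ} (hR : 0 ≤ R)
    (hc : ContinuousOn (Function.uncurry G) (U ×ˢ Metric.sphere c R))
    (hd : ∀ ζ ∈ Metric.sphere c R, DifferentiableOn ℂ (fun z => G z ζ) U) :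
    DifferentiableOn ℂ (fun z => ∮ ζ in C(c, R), G z ζ) U := by
  unfold circleIntegral
  refine differentiableOn_intervalIntegral_of_param hU ?_ ?_ _ _
  · have h1 : Continuous fun p : E × ℝ => deriv (circleMap c R) p.2 := by
      simp only [deriv_circleMap]; fun_prop
    refine h1.continuousOn.smul ?_
    exact hc.comp (f := fun p : E × ℝ => (p.1, circleMap c R p.2)) (by fun_prop)
      (fun p hp => ⟨hp.1, circleMap_mem_sphere c hR p.2⟩)
  · intro θ
    exact (hd _ (circleMap_mem_sphere c hR θ)).const_smul _

/-- Cauchy's formula on the complex line `t ↦ z + t • u` writes the directional derivative as a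
circle integral whose integrand is holomorphic in `z`. -/
theorem DifferentiableOn.fderiv_apply_of_isOpen [FiniteDimensional ℂ E] [CompleteSpace F]
    {f : E → F} {U : Set E} (hU : IsOpen U) (hf : DifferentiableOn ℂ f U) (u : E) :
    DifferentiableOn ℂ (fun z => fderiv ℂ f z u) U := by
  intro z₀ hz₀
  obtain ⟨δ, hδ, hδU⟩ := Metric.isOpen_iff.1 hU z₀ hz₀
  set r : ℝ := δ / (2 * (‖u‖ + 1)) with hr
  have hr0 : 0 < r := by positivity
  have hru : r * ‖u‖ ≤ δ / 2 := by
    rw [hr, div_mul_eq_mul_div, div_le_div_iff₀ (by positivity) (by positivity)]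
    nlinarith [norm_nonneg u]
  have hmem : ∀ z ∈ Metric.ball z₀ (δ / 2), ∀ t ∈ Metric.closedBall (0 : ℂ) r, z + t • u ∈ U := by
    intro z hz t ht
    refine hδU ?_
    rw [mem_ball_iff_norm] at hz ⊢
    rw [mem_closedBall_zero_iff] at ht
    calc ‖z + t • u - z₀‖ = ‖(z - z₀) + t • u‖ := by congr 1; abel
      _ ≤ ‖z - z₀‖ + ‖t‖ * ‖u‖ := by rw [← norm_smul]; exact norm_add_le _ _
      _ ≤ ‖z - z₀‖ + r * ‖u‖ := by gcongr
      _ < δ := by linarith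
  have hfor : ∀ z ∈ Metric.ball z₀ (δ / 2), fderiv ℂ f z u =
      (2 * Real.pi * Complex.I : ℂ)⁻¹ • ∮ ζ in C(0, r), (1 / (ζ - 0) ^ 2) • f (z + ζ • u) := by
    intro z hz
    have hline : ∀ t ∈ Metric.closedBall (0 : ℂ) r,
        HasDerivAt (fun t : ℂ => f (z + t • u)) (fderiv ℂ f (z + t • u) u) t := by
      intro t ht
      have h1 : HasFDerivAt f (fderiv ℂ f (z + t • u)) (z + t • u) :=
        (hf.differentiableAt (hU.mem_nhds (hmem z hz t ht))).hasFDerivAt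
      have h2 : HasDerivAt (fun t : ℂ => z + t • u) u t := by
        simpa using ((hasDerivAt_id t).smul_const u).const_add z
      exact h1.comp_hasDerivAt t h2
    have hD : DifferentiableOn ℂ (fun t : ℂ => f (z + t • u)) (Metric.closedBall 0 r) :=
      fun t ht => (hline t ht).differentiableAt.differentiableWithinAt
    rw [hD.deriv_eq_smul_circleIntegral hr0, (hline 0 (by simp [hr0.le])).deriv,
      inv_smul_smul₀ Complex.two_pi_I_ne_zero]
    simp
  have hdiff : DifferentiableOn ℂ (fun z => (2 * Real.pi * Complex.I : ℂ)⁻¹ •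
      ∮ ζ in C(0, r), (1 / (ζ - 0) ^ 2) • f (z + ζ • u)) (Metric.ball z₀ (δ / 2)) := by
    refine DifferentiableOn.const_smul ?_ _
    refine differentiableOn_circleIntegral_of_param Metric.isOpen_ball hr0.le ?_ ?_
    · refine ContinuousOn.smul (f := fun p : E × ℂ => 1 / (p.2 - 0) ^ 2)
        (g := fun p : E × ℂ => f (p.1 + p.2 • u)) ?_ ?_
      · refine ContinuousOn.div (by fun_prop) (by fun_prop) ?_
        rintro ⟨z, ζ⟩ ⟨-, hζ⟩ h0
        have : ζ = 0 := by simpa using h0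
        rw [this] at hζ
        simp at hζ
        exact hr0.ne hζ
      · refine hf.continuousOn.comp (f := fun p : E × ℂ => p.1 + p.2 • u) (by fun_prop) ?_
        rintro ⟨z, ζ⟩ ⟨hz, hζ⟩
        exact hmem z hz ζ (Metric.sphere_subset_closedBall hζ)
    · intro ζ hζ
      refine DifferentiableOn.const_smul ?_ _
      exact hf.comp (f := fun z : E => z + ζ • u) (by fun_prop) fun z hz =>
        hmem z hz ζ (Metric.sphere_subset_closedBall hζ)
  have hb := Metric.ball_mem_nhds z₀ (half_pos hδ)
  refine ((hdiff.differentiableAt hb).congr_of_eventuallyEq ?_).differentiableWithinAt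
  filter_upwards [hb] with z hz using hfor z hz

/-- The identity theorem on a convex open set. -/
theorem DifferentiableOn.eq_zero_of_convex_of_eventually_eq_zero [CompleteSpace F] {f : E → F}
    {U : Set E} (hU : IsOpen U) (hconv : Convex ℝ U) (hf : DifferentiableOn ℂ f U) {x : E}
    (hx : x ∈ U) (h0 : ∀ᶠ z in 𝓝 x, f z = 0) {y : E} (hy : y ∈ U) : f y = 0 := by
  -- Restricting to the complex line through `x` and `y` leaves a one-variable problem on a convex,
  -- hence connected, open set.
  set φ : ℂ → E := fun t => x + t • (y - x) with hφ
  have hφc : Continuous φ := by fun_prop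
  have hopen : IsOpen (φ ⁻¹' U) := hU.preimage hφc
  have hcv : Convex ℝ (φ ⁻¹' U) := by
    intro s hs t ht a b ha hb hab
    have := hconv hs ht ha hb hab
    simp only [Set.mem_preimage, hφ] at this ⊢
    convert this using 1
    rw [smul_add, smul_add, add_add_add_comm, ← add_smul a b x, hab, one_smul, add_smul,
      smul_assoc, smul_assoc]
  have hφ0 : φ 0 = x := by simp [hφ]
  have hφ1 : φ 1 = y := by simp [hφ]
  have hd : DifferentiableOn ℂ (f ∘ φ) (φ ⁻¹' U) :=
    hf.comp (by fun_prop) (Set.mapsTo_preimage _ _)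
  have han := hd.analyticOnNhd hopen
  have h0' : f ∘ φ =ᶠ[𝓝 0] 0 := by
    have : Filter.Tendsto φ (𝓝 0) (𝓝 x) := by
      have := hφc.tendsto 0
      rwa [hφ0] at this
    exact this.eventually h0
  have := han.eqOn_zero_of_preconnected_of_eventuallyEq_zero hcv.isPreconnected
    (z₀ := 0) (by simpa [hφ0] using hx) h0'
  have h1 := this (x := 1) (by simpa [hφ1] using hy)
  simpa [hφ1] using h1

end SeveralVariables

/-! ### Rigidity of closed decompositions. -/

section LocalDecompositions

/-- `(α, β)` is, to first order at `y`, a pair of closed holomorphic 1-forms, and `α β = W` at `y`. -/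
structure IsClosedDecompAt (W : C2 → C2 → ℂ) (α β : C2 → C2 →L[ℂ] ℂ) (y : C2) : Prop where
  left_diff : DifferentiableAt ℂ α y
  right_diff : DifferentiableAt ℂ β y
  left_closed : ∀ u v, fderiv ℂ α y u v = fderiv ℂ α y v u
  right_closed : ∀ u v, fderiv ℂ β y u v = fderiv ℂ β y v u
  mul_eq : ∀ v, α y v * β y v = W y v

/-- `W` is a product of two closed holomorphic 1-forms on `U`. -/
def HasClosedDecomp (W : C2 → C2 → ℂ) (U : Set C2) : Prop :=
  ∃ α β : C2 → C2 →L[ℂ] ℂ, ∀ y ∈ U, IsClosedDecompAt W α β y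

/-- The discriminant of the quadratic form `q` on `ℂ²`. -/
noncomputable def quadDisc (q : C2 → ℂ) : ℂ :=
  (q (EuclideanSpace.single 0 1 + EuclideanSpace.single 1 1) - q (EuclideanSpace.single 0 1)
    - q (EuclideanSpace.single 1 1)) ^ 2
    - 4 * q (EuclideanSpace.single 0 1) * q (EuclideanSpace.single 1 1)

/-- The determinant of a pair of linear forms on `ℂ²`. -/
noncomputable def wedge (a b : C2 →L[ℂ] ℂ) : ℂ :=
  a (EuclideanSpace.single 0 1) * b (EuclideanSpace.single 1 1)
    - a (EuclideanSpace.single 1 1) * b (EuclideanSpace.single 0 1)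

/-- The vector spanning the kernel of the linear form `a`. -/
noncomputable def kerVec (a : C2 →L[ℂ] ℂ) : C2 :=
  a (EuclideanSpace.single 1 1) • EuclideanSpace.single 0 1
    - a (EuclideanSpace.single 0 1) • EuclideanSpace.single 1 1

theorem apply_kerVec (a b : C2 →L[ℂ] ℂ) : a (kerVec b) = wedge a b := by
  simp only [kerVec, wedge, map_sub, map_smul, smul_eq_mul]; ring

theorem wedge_self (a : C2 →L[ℂ] ℂ) : wedge a a = 0 := by unfold wedge; ring

theorem wedge_comm (a b : C2 →L[ℂ] ℂ) : wedge a b = -wedge b a := by unfold wedge; ring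

theorem C2.eq_sum (v : C2) :
    v = v 0 • EuclideanSpace.single 0 1 + v 1 • EuclideanSpace.single 1 1 := by
  ext i
  fin_cases i <;> simp

theorem C2.clm_ext {a b : C2 →L[ℂ] ℂ}
    (h0 : a (EuclideanSpace.single 0 1) = b (EuclideanSpace.single 0 1))
    (h1 : a (EuclideanSpace.single 1 1) = b (EuclideanSpace.single 1 1)) : a = b := by
  ext v
  rw [C2.eq_sum v, map_add, map_add, map_smul, map_smul, map_smul, map_smul, h0, h1]

/-- Nonvanishing of the wedge of two factors thus depends only on their product, not on the chosen
factorisation. -/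
theorem quadDisc_mul (a b : C2 →L[ℂ] ℂ) : quadDisc (fun v => a v * b v) = wedge a b ^ 2 := by
  simp only [quadDisc, wedge, map_add]; ring

theorem IsClosedDecompAt.quadDisc_eq {W : C2 → C2 → ℂ} {α β : C2 → C2 →L[ℂ] ℂ} {y : C2}
    (h : IsClosedDecompAt W α β y) : quadDisc (W y) = wedge (α y) (β y) ^ 2 := by
  rw [← quadDisc_mul, show (fun v => α y v * β y v) = W y from funext h.mul_eq]

theorem IsClosedDecompAt.swap {W : C2 → C2 → ℂ} {α β : C2 → C2 →L[ℂ] ℂ} {y : C2}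
    (h : IsClosedDecompAt W α β y) : IsClosedDecompAt W β α y :=
  ⟨h.right_diff, h.left_diff, h.right_closed, h.left_closed, fun v => by
    rw [mul_comm]; exact h.mul_eq v⟩

theorem IsClosedDecompAt.smul {W : C2 → C2 → ℂ} {α β : C2 → C2 →L[ℂ] ℂ} {y : C2}
    (h : IsClosedDecompAt W α β y) {c : ℂ} (hc : c ≠ 0) :
    IsClosedDecompAt W (fun z => c • α z) (fun z => c⁻¹ • β z) y := by
  refine ⟨h.left_diff.const_smul c, h.right_diff.const_smul c⁻¹, fun u v => ?_, fun u v => ?_,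
    fun v => ?_⟩
  · rw [fderiv_fun_const_smul h.left_diff]
    simp [h.left_closed u v]
  · rw [fderiv_fun_const_smul h.right_diff]
    simp [h.right_closed u v]
  · rw [← h.mul_eq v]
    simp only [smul_apply, smul_eq_mul]
    field_simp

theorem IsClosedDecompAt.congr {W : C2 → C2 → ℂ} {α β α' β' : C2 → C2 →L[ℂ] ℂ} {y : C2}
    (h : IsClosedDecompAt W α β y) (hα : α' =ᶠ[𝓝 y] α) (hβ : β' =ᶠ[𝓝 y] β) :
    IsClosedDecompAt W α' β' y := by
  refine ⟨h.left_diff.congr_of_eventuallyEq hα, h.right_diff.congr_of_eventuallyEq hβ,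
    ?_, ?_, ?_⟩
  · rw [hα.fderiv_eq]; exact h.left_closed
  · rw [hβ.fderiv_eq]; exact h.right_closed
  · rw [hα.eq_of_nhds, hβ.eq_of_nhds]; exact h.mul_eq

theorem exists_mul_ne_zero {a b : C2 →L[ℂ] ℂ} (hab : wedge a b ≠ 0) : ∃ v, a v * b v ≠ 0 := by
  by_contra! hcon
  have h := quadDisc_mul a b
  rw [show (fun v => a v * b v) = fun _ => 0 from funext hcon] at h
  have h2 : wedge a b ^ 2 = 0 := by rw [← h]; simp [quadDisc]
  exact hab (pow_eq_zero_iff two_ne_zero |>.1 h2)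

/-- If `a b` and `a' b'` are equal and `a' ∉ ℂ b`, then `a' ∈ ℂ a` and `b' ∈ ℂ b`. -/
theorem proportional_of_mul_eq {a b a' b' : C2 →L[ℂ] ℂ} (h : ∀ v, a' v * b' v = a v * b v)
    (hab : wedge a b ≠ 0) (ha'b : wedge a' b ≠ 0) :
    a' = (wedge a' b / wedge a b) • a ∧ b' = (wedge a' b / wedge a b)⁻¹ • b := by
  -- Evaluate the identity on the kernel of `b`, where the right side vanishes and `a'` does not.
  have hb' : wedge b' b = 0 := by
    have := h (kerVec b)
    rw [apply_kerVec, apply_kerVec, apply_kerVec, apply_kerVec, wedge_self, mul_zero] at this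
    exact (mul_eq_zero.1 this).resolve_left ha'b
  -- On the kernel of `a` one of `a'`, `b'` vanishes. If it were `b'`, then `b'` would be
  -- proportional to both `a` and `b`, hence zero, against `a b ≠ 0`.
  have ha' : wedge a' a = 0 := by
    have h1 := h (kerVec a)
    rw [apply_kerVec, apply_kerVec, apply_kerVec, apply_kerVec, wedge_self, zero_mul] at h1
    refine (mul_eq_zero.1 h1).resolve_right fun hb'a => ?_
    have hz : b' = 0 := by
      refine C2.clm_ext ?_ ?_ <;> simp only [zero_apply] <;>
        refine (mul_eq_zero.1 ?_).resolve_right hab <;> unfold wedge at * <;>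
        [linear_combination a (EuclideanSpace.single 0 1) * hb'
          - b (EuclideanSpace.single 0 1) * hb'a;
         linear_combination a (EuclideanSpace.single 1 1) * hb'
          - b (EuclideanSpace.single 1 1) * hb'a]
    obtain ⟨v, hv⟩ := exists_mul_ne_zero hab
    exact hv (by rw [← h v, hz]; simp)
  have e1 : a' = (wedge a' b / wedge a b) • a := by
    refine C2.clm_ext ?_ ?_ <;> simp only [smul_apply, smul_eq_mul] <;>
      rw [div_mul_eq_mul_div, eq_div_iff hab] <;> unfold wedge at * <;>
      [linear_combination (-b (EuclideanSpace.single 0 1)) * ha';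
       linear_combination (-b (EuclideanSpace.single 1 1)) * ha']
  refine ⟨e1, ?_⟩
  set f := wedge a' b / wedge a b with hf
  have hf0 : f ≠ 0 := div_ne_zero ha'b hab
  have e2 : b' = (wedge a b' / wedge a b) • b := by
    refine C2.clm_ext ?_ ?_ <;> simp only [smul_apply, smul_eq_mul] <;>
      rw [div_mul_eq_mul_div, eq_div_iff hab] <;> unfold wedge at * <;>
      [linear_combination (a (EuclideanSpace.single 0 1)) * hb';
       linear_combination (a (EuclideanSpace.single 1 1)) * hb']
  have e4 : f * (wedge a b' / wedge a b) = 1 := by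
    obtain ⟨v, hv⟩ := exists_mul_ne_zero hab
    have h5 := h v
    rw [e1, e2] at h5
    simp only [smul_apply, smul_eq_mul] at h5
    apply mul_right_cancel₀ hv
    linear_combination h5
  rw [eq_inv_of_mul_eq_one_right e4] at e2
  exact e2

/-- From `d(f α) = df ∧ α + f dα`: if `α` and `f α` are closed, then `df ∧ α = 0`. -/
theorem fderiv_wedge_eq_zero_of_closed_smul {α γ : C2 → C2 →L[ℂ] ℂ} {f : C2 → ℂ} {y : C2}
    (hα : DifferentiableAt ℂ α y) (hf : DifferentiableAt ℂ f y)
    (hαc : ∀ u v, fderiv ℂ α y u v = fderiv ℂ α y v u)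
    (hγc : ∀ u v, fderiv ℂ γ y u v = fderiv ℂ γ y v u)
    (hγ : γ =ᶠ[𝓝 y] fun z => f z • α z) (u v : C2) :
    fderiv ℂ f y u * α y v = fderiv ℂ f y v * α y u := by
  have h := hγc u v
  rw [hγ.fderiv_eq, fderiv_fun_smul hf hα] at h
  simp only [add_apply, smul_apply, ContinuousLinearMap.smulRight_apply, smul_eq_mul] at h
  rw [hαc u v] at h
  linear_combination h

theorem differentiableAt_wedge {α β : C2 → C2 →L[ℂ] ℂ} {y : C2}
    (hα : DifferentiableAt ℂ α y) (hβ : DifferentiableAt ℂ β y) :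
    DifferentiableAt ℂ (fun z => wedge (α z) (β z)) y := by
  unfold wedge
  fun_prop

/-- The ratio `f` of `α'` to `α` satisfies `df ∧ α = 0` and, through `f⁻¹`, also `df ∧ β = 0`;
independence of `α` and `β` forces `df = 0`. The hypothesis on `α'` and `β` fixes the order of the
factors. -/
theorem eventually_eq_const_smul_of_decomp {W : C2 → C2 → ℂ} {α β α' β' : C2 → C2 →L[ℂ] ℂ}
    {x : C2} (h : ∀ᶠ y in 𝓝 x, IsClosedDecompAt W α β y)
    (h' : ∀ᶠ y in 𝓝 x, IsClosedDecompAt W α' β' y)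
    (hαβ : wedge (α x) (β x) ≠ 0) (hα'β : wedge (α' x) (β x) ≠ 0) :
    ∃ c : ℂ, c ≠ 0 ∧ ∀ᶠ y in 𝓝 x, α' y = c • α y ∧ β' y = c⁻¹ • β y := by
  set f : C2 → ℂ := fun y => wedge (α' y) (β y) / wedge (α y) (β y) with hf
  have n1 : ∀ᶠ y in 𝓝 x, wedge (α y) (β y) ≠ 0 :=
    (differentiableAt_wedge h.self_of_nhds.left_diff
      h.self_of_nhds.right_diff).continuousAt.eventually_ne hαβ
  have n2 : ∀ᶠ y in 𝓝 x, wedge (α' y) (β y) ≠ 0 :=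
    (differentiableAt_wedge h'.self_of_nhds.left_diff
      h.self_of_nhds.right_diff).continuousAt.eventually_ne hα'β
  have hall : ∀ᶠ y in 𝓝 x, (IsClosedDecompAt W α β y ∧ IsClosedDecompAt W α' β' y) ∧
      (wedge (α y) (β y) ≠ 0 ∧ wedge (α' y) (β y) ≠ 0) ∧
      (α' y = f y • α y ∧ β' y = (f y)⁻¹ • β y) := by
    filter_upwards [h, h', n1, n2] with y a1 a2 a3 a4
    exact ⟨⟨a1, a2⟩, ⟨a3, a4⟩, proportional_of_mul_eq
      (fun v => by rw [a1.mul_eq, a2.mul_eq]) a3 a4⟩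
  have hf0 : ∀ᶠ y in 𝓝 x, DifferentiableAt ℂ f y ∧ fderiv ℂ f y = 0 := by
    filter_upwards [hall.eventually_nhds] with y hy
    obtain ⟨⟨a1, a2⟩, ⟨a3, a4⟩, -⟩ := hy.self_of_nhds
    have hfd : DifferentiableAt ℂ f y := by
      simp only [hf, div_eq_mul_inv]
      exact (differentiableAt_wedge a2.left_diff a1.right_diff).mul
        ((differentiableAt_wedge a1.left_diff a1.right_diff).inv a3)
    have hfy : f y ≠ 0 := div_ne_zero a4 a3
    refine ⟨hfd, ?_⟩
    have e1 := fderiv_wedge_eq_zero_of_closed_smul a1.left_diff hfd a1.left_closed a2.left_closed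
      (hy.mono fun z hz => hz.2.2.1)
    have e2 := fderiv_wedge_eq_zero_of_closed_smul a1.right_diff (hfd.inv hfy) a1.right_closed
      a2.right_closed (hy.mono fun z hz => hz.2.2.2)
    have e3 : ∀ u v, fderiv ℂ f y u * β y v = fderiv ℂ f y v * β y u := by
      intro u v
      have := e2 u v
      rw [show fderiv ℂ f⁻¹ y = (-(f y ^ 2)⁻¹) • fderiv ℂ f y from
        ((hasDerivAt_inv hfy).comp_hasFDerivAt y hfd.hasFDerivAt).fderiv] at this
      simp only [smul_apply, smul_eq_mul] at this
      have h2 : -(f y ^ 2)⁻¹ ≠ 0 := neg_ne_zero.2 (inv_ne_zero (pow_ne_zero 2 hfy))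
      apply mul_left_cancel₀ h2
      linear_combination this
    set p : C2 := EuclideanSpace.single 0 1
    set q : C2 := EuclideanSpace.single 1 1
    refine C2.clm_ext ?_ ?_ <;> simp only [zero_apply] <;>
      refine (mul_eq_zero.1 ?_).resolve_right a3 <;> unfold wedge <;>
      [linear_combination α y p * e3 p q - β y p * e1 p q;
       linear_combination α y q * e3 p q - β y q * e1 p q]
  obtain ⟨δ, hδ, hball⟩ := Metric.eventually_nhds_iff_ball.1 hf0
  have hconst : ∀ y ∈ Metric.ball x δ, f y = f x := fun y hy =>
    Metric.isOpen_ball.is_const_of_fderiv_eq_zero (𝕜 := ℂ)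
      (convex_ball x δ).isPreconnected
      (fun z hz => (hball z hz).1.differentiableWithinAt) (fun z hz => (hball z hz).2) hy
      (Metric.mem_ball_self hδ)
  refine ⟨f x, div_ne_zero hα'β hαβ, ?_⟩
  filter_upwards [hall, Metric.ball_mem_nhds x hδ] with y hy hyb
  rw [← hconst y hyb]
  exact hy.2.2

theorem eq_on_convex_of_eventually_eq {α β : C2 → C2 →L[ℂ] ℂ} {U : Set C2} (hU : IsOpen U)
    (hconv : Convex ℝ U) (hα : ∀ y ∈ U, DifferentiableAt ℂ α y)
    (hβ : ∀ y ∈ U, DifferentiableAt ℂ β y) {x : C2} (hx : x ∈ U) (h : ∀ᶠ y in 𝓝 x, α y = β y) :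
    ∀ y ∈ U, α y = β y := by
  intro y hy
  rw [← sub_eq_zero]
  exact DifferentiableOn.eq_zero_of_convex_of_eventually_eq_zero (f := fun y => α y - β y) hU hconv
    (fun z hz => ((hα z hz).sub (hβ z hz)).differentiableWithinAt) hx
    (h.mono fun z hz => sub_eq_zero.2 hz) hy

/-- Closed decompositions of a form of rank two on a convex open set are unique up to the order of
the factors and a constant. -/
theorem closedDecomp_unique {W : C2 → C2 → ℂ} {α β α' β' : C2 → C2 →L[ℂ] ℂ} {U : Set C2}
    (hU : IsOpen U) (hconv : Convex ℝ U) (h : ∀ y ∈ U, IsClosedDecompAt W α β y)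
    (h' : ∀ y ∈ U, IsClosedDecompAt W α' β' y) (hW : ∃ x ∈ U, quadDisc (W x) ≠ 0) :
    ∃ c : ℂ, c ≠ 0 ∧ ((∀ y ∈ U, α' y = c • α y ∧ β' y = c⁻¹ • β y) ∨
      (∀ y ∈ U, α' y = c • β y ∧ β' y = c⁻¹ • α y)) := by
  obtain ⟨x, hx, hWx⟩ := hW
  have hαβ : wedge (α x) (β x) ≠ 0 := fun h0 => hWx (by rw [(h x hx).quadDisc_eq, h0]; simp)
  have spread : ∀ {a b : C2 → C2 →L[ℂ] ℂ}, (∀ y ∈ U, IsClosedDecompAt W a b y) →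
      wedge (a x) (b x) ≠ 0 → wedge (α' x) (b x) ≠ 0 →
      ∃ c : ℂ, c ≠ 0 ∧ ∀ y ∈ U, α' y = c • a y ∧ β' y = c⁻¹ • b y := by
    intro a b hab n1 n2
    obtain ⟨c, hc, he⟩ := eventually_eq_const_smul_of_decomp
      (Filter.mem_of_superset (hU.mem_nhds hx) hab) (Filter.mem_of_superset (hU.mem_nhds hx) h')
      n1 n2
    have e1 := eq_on_convex_of_eventually_eq hU hconv (fun y hy => (h' y hy).left_diff)
      (fun y hy => ((hab y hy).smul hc).left_diff) hx (he.mono fun _ h => h.1)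
    have e2 := eq_on_convex_of_eventually_eq hU hconv (fun y hy => (h' y hy).right_diff)
      (fun y hy => ((hab y hy).smul hc).right_diff) hx (he.mono fun _ h => h.2)
    exact ⟨c, hc, fun y hy => ⟨e1 y hy, e2 y hy⟩⟩
  -- This decides the order of the factors: `α' x` cannot be proportional to both `α x` and `β x`,
  -- since it would then vanish.
  by_cases hcase : wedge (α' x) (β x) = 0
  · have h2 : wedge (α' x) (α x) ≠ 0 := by
      intro h3
      obtain ⟨v, hv⟩ := exists_mul_ne_zero hαβ
      apply hv
      rw [(h x hx).mul_eq, ← (h' x hx).mul_eq, show α' x = 0 from ?_]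
      · simp
      set p : C2 := EuclideanSpace.single 0 1
      set q : C2 := EuclideanSpace.single 1 1
      refine C2.clm_ext ?_ ?_ <;> simp only [zero_apply] <;>
        refine (mul_eq_zero.1 ?_).resolve_right hαβ <;> unfold wedge at * <;>
        [linear_combination α x p * hcase - β x p * h3;
         linear_combination α x q * hcase - β x q * h3]
    obtain ⟨c, hc, he⟩ := spread (fun y hy => (h y hy).swap)
      (fun h0 => hαβ (by rw [wedge_comm, h0, neg_zero])) h2
    exact ⟨c, hc, Or.inr he⟩
  · obtain ⟨c, hc, he⟩ := spread h hαβ hcase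
    exact ⟨c, hc, Or.inl he⟩

end LocalDecompositions

/-! ### Gluing decompositions without monodromy. -/

section Gluing

theorem HasClosedDecomp.mono {W : C2 → C2 → ℂ} {U V : Set C2} (h : HasClosedDecomp W V)
    (hUV : U ⊆ V) : HasClosedDecomp W U :=
  let ⟨α, β, hd⟩ := h
  ⟨α, β, fun y hy => hd y (hUV hy)⟩

/-- `W` has rank two at the general point of `D`. -/
def GenericallyNondegenerateOn (W : C2 → C2 → ℂ) (D : Set C2) : Prop :=
  ∀ V ⊆ D, IsOpen V → V.Nonempty → ∃ x ∈ V, quadDisc (W x) ≠ 0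

theorem GenericallyNondegenerateOn.mono {W : C2 → C2 → ℂ} {U V : Set C2}
    (h : GenericallyNondegenerateOn W V) (hUV : U ⊆ V) : GenericallyNondegenerateOn W U :=
  fun S hS => h S (hS.trans hUV)

/-- Closed decompositions on convex open sets glue if nonempty double intersections meet a
distinguished member of the family. -/
theorem hasClosedDecomp_iUnion {W : C2 → C2 → ℂ} {ι : Type*} {U : ι → Set C2} (i₀ : ι)
    (hopen : ∀ i, IsOpen (U i)) (hconv : ∀ i, Convex ℝ (U i)) (hne : ∀ i, (U i).Nonempty)
    (htri : ∀ i j, (U i ∩ U j).Nonempty → (U i₀ ∩ (U i ∩ U j)).Nonempty)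
    (hW : ∀ i, GenericallyNondegenerateOn W (U i)) (hdec : ∀ i, HasClosedDecomp W (U i)) :
    HasClosedDecomp W (⋃ i, U i) := by
  choose A B hAB using hdec
  -- By rigidity, each decomposition can be swapped and rescaled to match the one on `U i₀` over
  -- their overlap.
  have hnorm : ∀ i, ∃ a b : C2 → C2 →L[ℂ] ℂ, (∀ y ∈ U i, IsClosedDecompAt W a b y) ∧
      ∀ y ∈ U i₀ ∩ U i, a y = A i₀ y ∧ b y = B i₀ y := by
    intro i
    have hne' : (U i₀ ∩ U i).Nonempty := by
      have := htri i i (by simpa using hne i)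
      simpa using this
    obtain ⟨c, hc, h | h⟩ := closedDecomp_unique ((hopen i₀).inter (hopen i))
      ((hconv i₀).inter (hconv i)) (fun y hy => hAB i y hy.2) (fun y hy => hAB i₀ y hy.1)
      (hW i _ Set.inter_subset_right ((hopen i₀).inter (hopen i)) hne')
    · exact ⟨fun y => c • A i y, fun y => c⁻¹ • B i y, fun y hy => (hAB i y hy).smul hc,
        fun y hy => ⟨(h y hy).1.symm, (h y hy).2.symm⟩⟩
    · exact ⟨fun y => c • B i y, fun y => c⁻¹ • A i y, fun y hy => (hAB i y hy).swap.smul hc,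
        fun y hy => ⟨(h y hy).1.symm, (h y hy).2.symm⟩⟩
  choose a b hab hbase using hnorm
  -- Both coincide with the distinguished decomposition on a nonempty open part of the convex
  -- overlap, so the identity theorem applies.
  have hagree : ∀ i j, ∀ y ∈ U i ∩ U j, a i y = a j y ∧ b i y = b j y := by
    intro i j y hy
    obtain ⟨x, hx⟩ := htri i j ⟨y, hy⟩
    have hO : IsOpen (U i ∩ U j) := (hopen i).inter (hopen j)
    have hC : Convex ℝ (U i ∩ U j) := (hconv i).inter (hconv j)
    have hev : ∀ᶠ z in 𝓝 x, z ∈ U i₀ ∩ (U i ∩ U j) := ((hopen i₀).inter hO).mem_nhds hx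
    refine ⟨eq_on_convex_of_eventually_eq hO hC (fun z hz => (hab i z hz.1).left_diff)
      (fun z hz => (hab j z hz.2).left_diff) hx.2 ?_ y hy,
      eq_on_convex_of_eventually_eq hO hC (fun z hz => (hab i z hz.1).right_diff)
      (fun z hz => (hab j z hz.2).right_diff) hx.2 ?_ y hy⟩
    · filter_upwards [hev] with z hz
      rw [(hbase i z ⟨hz.1, hz.2.1⟩).1, (hbase j z ⟨hz.1, hz.2.2⟩).1]
    · filter_upwards [hev] with z hz
      rw [(hbase i z ⟨hz.1, hz.2.1⟩).2, (hbase j z ⟨hz.1, hz.2.2⟩).2]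
  classical
  -- Any member containing `y` serves, by `hagree`; the default `i₀` only matters outside the union.
  let idx : C2 → ι := fun y => if h : ∃ i, y ∈ U i then h.choose else i₀
  have hidx : ∀ i, ∀ y ∈ U i, y ∈ U (idx y) := by
    intro i y hy
    have h : ∃ i, y ∈ U i := ⟨i, hy⟩
    simp only [idx, dif_pos h]
    exact h.choose_spec
  refine ⟨fun y => a (idx y) y, fun y => b (idx y) y, fun y hy => ?_⟩
  obtain ⟨i, hi⟩ := Set.mem_iUnion.1 hy
  refine (hab i y hi).congr ?_ ?_
  · filter_upwards [(hopen i).mem_nhds hi] with z hz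
    exact (hagree _ _ z ⟨hidx i z hz, hz⟩).1
  · filter_upwards [(hopen i).mem_nhds hi] with z hz
    exact (hagree _ _ z ⟨hidx i z hz, hz⟩).2

/-- On a relatively compact convex open set, local closed decompositions yield a global one. -/
theorem hasClosedDecomp_of_convex {W : C2 → C2 → ℂ} {C K : Set C2} (hC : IsOpen C)
    (hconv : Convex ℝ C) (hCK : C ⊆ K) (hK : IsCompact K) (hW : GenericallyNondegenerateOn W C)
    (hloc : ∀ x ∈ K, ∃ V, IsOpen V ∧ x ∈ V ∧ HasClosedDecomp W V) : HasClosedDecomp W C := by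
  rcases C.eq_empty_or_nonempty with rfl | ⟨p, hp⟩
  · exact ⟨0, 0, fun y hy => hy.elim⟩
  choose V hVo hxV hVd using hloc
  obtain ⟨δ, hδ, hball⟩ := lebesgue_number_lemma_of_metric (c := fun x : K => V x x.2) hK
    (fun x => hVo _ _) (fun x hx => Set.mem_iUnion.2 ⟨⟨x, hx⟩, hxV x hx⟩)
  have hdec : ∀ x ∈ C, HasClosedDecomp W (C ∩ Metric.ball x δ) := by
    intro x hx
    obtain ⟨i, hi⟩ := hball x (hCK hx)
    exact (hVd _ i.2).mono (Set.inter_subset_right.trans hi)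
  -- Concentric balls grow by `δ / 2` per step: the set `S` already reached is the distinguished
  -- member, and the pieces `C ∩ ball x δ` with `x ∈ S` are glued to it.
  have hsweep : ∀ n : ℕ, HasClosedDecomp W (C ∩ Metric.ball p ((n + 1) * (δ / 2))) := by
    intro n
    induction n with
    | zero =>
      refine (hdec p hp).mono (Set.inter_subset_inter_right _ (Metric.ball_subset_ball ?_))
      push_cast; linarith
    | succ n ih =>
      set S : Set C2 := C ∩ Metric.ball p ((n + 1) * (δ / 2)) with hS
      have hSconv : Convex ℝ S := hconv.inter (convex_ball _ _)
      have hSopen : IsOpen S := hC.inter Metric.isOpen_ball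
      have hpS : p ∈ S := ⟨hp, Metric.mem_ball_self (by positivity)⟩
      -- If two `δ`-balls meet, their centres are less than `2δ` apart, so the midpoint lies in both
      -- balls, and in `S` by convexity.
      have hmid : ∀ x ∈ S, ∀ y ∈ S, (C ∩ Metric.ball x δ ∩ (C ∩ Metric.ball y δ)).Nonempty →
          (S ∩ (C ∩ Metric.ball x δ ∩ (C ∩ Metric.ball y δ))).Nonempty := by
        rintro x hx y hy ⟨z, hz1, hz2⟩
        have hmS : midpoint ℝ x y ∈ S := hSconv.midpoint_mem hx hy
        have hxy : dist x y < δ + δ := by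
          have h1 := Metric.mem_ball'.1 hz1.2
          have h2 := Metric.mem_ball.1 hz2.2
          linarith [dist_triangle x z y]
        refine ⟨_, hmS, ⟨hmS.1, ?_⟩, hmS.1, ?_⟩
        · rw [Metric.mem_ball, dist_midpoint_left, Real.norm_ofNat]; linarith
        · rw [Metric.mem_ball, dist_midpoint_right, Real.norm_ofNat]; linarith
      let U : Option S → Set C2 := fun o => o.elim S fun x => C ∩ Metric.ball (x : C2) δ
      have hUC : ∀ i, U i ⊆ C := by
        rintro (_ | x)
        · exact Set.inter_subset_left
        · exact Set.inter_subset_left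
      have hself : ∀ x : S, (x : C2) ∈ C ∩ Metric.ball (x : C2) δ := fun x =>
        ⟨x.2.1, Metric.mem_ball_self hδ⟩
      have hglue : HasClosedDecomp W (⋃ i, U i) := by
        refine hasClosedDecomp_iUnion none ?_ ?_ ?_ ?_ (fun i => hW.mono (hUC i)) ?_
        · rintro (_ | x)
          · exact hSopen
          · exact hC.inter Metric.isOpen_ball
        · rintro (_ | x)
          · exact hSconv
          · exact hconv.inter (convex_ball _ _)
        · rintro (_ | x)
          · exact ⟨p, hpS⟩
          · exact ⟨x, hself x⟩
        · rintro (_ | x) (_ | y) h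
          · exact ⟨p, hpS, hpS, hpS⟩
          · exact ⟨y, y.2, y.2, hself y⟩
          · exact ⟨x, x.2, hself x, x.2⟩
          · exact hmid x x.2 y y.2 h
        · rintro (_ | x)
          · exact ih
          · exact hdec x x.2.1
      refine hglue.mono ?_
      rintro y ⟨hyC, hy⟩
      rw [mem_ball_iff_norm] at hy
      push_cast at hy
      -- Shrinking `y` towards `p` by the ratio of consecutive radii lands in `S` and moves `y` by
      -- at most `δ / 2`.
      set s : ℝ := (n + 1) / (n + 2) with hs
      have hs0 : 0 ≤ s := by positivity
      have hs1 : 1 - s = 1 / (n + 2) := by rw [hs]; field_simp; ring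
      have hy' : ‖y - p‖ < (n + 2) * (δ / 2) := by linarith
      have hs1' : 0 ≤ 1 - s := by rw [hs1]; positivity
      have hx : p + s • (y - p) ∈ S := by
        refine ⟨hconv.add_smul_sub_mem hp hyC ⟨hs0, by linarith⟩, ?_⟩
        rw [mem_ball_iff_norm, add_sub_cancel_left, norm_smul, Real.norm_of_nonneg hs0]
        calc s * ‖y - p‖ < s * ((n + 2) * (δ / 2)) := by
              apply mul_lt_mul_of_pos_left hy'; positivity
          _ = (n + 1) * (δ / 2) := by rw [hs]; field_simp
      refine Set.mem_iUnion.2 ⟨some ⟨_, hx⟩, hyC, ?_⟩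
      rw [mem_ball_iff_norm, show y - (p + s • (y - p)) = (1 - s) • (y - p) by
        rw [sub_smul, one_smul]; abel, norm_smul, Real.norm_of_nonneg hs1']
      calc (1 - s) * ‖y - p‖ ≤ (1 - s) * ((n + 2) * (δ / 2)) := by gcongr
        _ = δ / 2 := by rw [hs1]; field_simp
        _ < δ := by linarith
  obtain ⟨R, hR⟩ := (Metric.isBounded_iff_subset_ball p).1 (hK.isBounded.subset hCK)
  obtain ⟨n, hn⟩ := exists_nat_gt (R / (δ / 2))
  refine (hsweep n).mono fun y hy => ⟨hy, Metric.ball_subset_ball ?_ (hR hy)⟩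
  rw [div_lt_iff₀ (by positivity)] at hn
  nlinarith

end Gluing

/-! ### Hartogs extension across the centre of a ball. -/

section Hartogs

/-- The open bidisc with centre `(p, q)` and radii `ρ`, `σ`. -/
def bidisc (p q : ℂ) (ρ σ : ℝ) : Set C2 := {y | y 0 ∈ Metric.ball p ρ ∧ y 1 ∈ Metric.ball q σ}

/-- The closed bidisc with centre `(p, q)` and radii `ρ`, `σ`. -/
def closedBidisc (p q : ℂ) (ρ σ : ℝ) : Set C2 :=
  {y | y 0 ∈ Metric.closedBall p ρ ∧ y 1 ∈ Metric.closedBall q σ}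

theorem bidisc_subset_closedBidisc {p q : ℂ} {ρ σ : ℝ} : bidisc p q ρ σ ⊆ closedBidisc p q ρ σ :=
  fun _ h => ⟨Metric.ball_subset_closedBall h.1, Metric.ball_subset_closedBall h.2⟩

theorem isOpen_bidisc {p q : ℂ} {ρ σ : ℝ} : IsOpen (bidisc p q ρ σ) :=
  (Metric.isOpen_ball.preimage (by fun_prop : Continuous fun y : C2 => y 0)).inter
    (Metric.isOpen_ball.preimage (by fun_prop : Continuous fun y : C2 => y 1))

theorem convex_bidisc {p q : ℂ} {ρ σ : ℝ} : Convex ℝ (bidisc p q ρ σ) := by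
  intro x hx y hy a b ha hb hab
  exact ⟨by simpa using (convex_ball p ρ) hx.1 hy.1 ha hb hab,
    by simpa using (convex_ball q σ) hx.2 hy.2 ha hb hab⟩

theorem C2.norm_le (y : C2) : ‖y‖ ≤ ‖y 0‖ + ‖y 1‖ := by
  conv_lhs => rw [C2.eq_sum y]
  refine (norm_add_le _ _).trans ?_
  simp [norm_smul]

theorem closedBidisc_subset_closedBall (c : C2) {p q : ℂ} {ρ σ : ℝ} :
    closedBidisc p q ρ σ ⊆ Metric.closedBall c (‖p - c 0‖ + ρ + (‖q - c 1‖ + σ)) := by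
  intro y hy
  rw [mem_closedBall_iff_norm]
  refine (C2.norm_le _).trans (add_le_add ?_ ?_)
  · have h1 := mem_closedBall_iff_norm.1 hy.1
    have h2 := norm_sub_le_norm_sub_add_norm_sub (y 0) p (c 0)
    simp only [PiLp.sub_apply]
    linarith
  · have h1 := mem_closedBall_iff_norm.1 hy.2
    have h2 := norm_sub_le_norm_sub_add_norm_sub (y 1) q (c 1)
    simp only [PiLp.sub_apply]
    linarith

theorem isCompact_closedBidisc {p q : ℂ} {ρ σ : ℝ} : IsCompact (closedBidisc p q ρ σ) := by
  refine (isCompact_closedBall (0 : C2) _).of_isClosed_subset ?_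
    (closedBidisc_subset_closedBall 0)
  exact (Metric.isClosed_closedBall.preimage (by fun_prop : Continuous fun y : C2 => y 0)).inter
    (Metric.isClosed_closedBall.preimage (by fun_prop : Continuous fun y : C2 => y 1))

/-- A closed decomposition extends over the bidisc if it extends over a Hartogs figure. -/
theorem hasClosedDecomp_bidisc_of_hartogsFigure {W : C2 → C2 → ℂ} {p q p' : ℂ} {ρ ρ' σ : ℝ}
    (hσ : 0 < σ) (hρ' : 0 < ρ') (hpp' : Metric.ball p' ρ' ⊆ Metric.ball p ρ) {T : Set C2}
    (hWd : ∀ v, DifferentiableOn ℂ (fun y => W y v) (bidisc p q ρ σ))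
    (hdec : HasClosedDecomp W T)
    (hcyl : ∀ y : C2, y 0 ∈ Metric.ball p ρ → y 1 ∈ Metric.sphere q σ → y ∈ T)
    (hslice : ∀ y : C2, y 0 ∈ Metric.ball p' ρ' → y 1 ∈ Metric.closedBall q σ → y ∈ T) :
    HasClosedDecomp W (bidisc p q ρ σ) := by
  obtain ⟨α, β, hαβ⟩ := hdec
  have hpair : Continuous fun z : C2 × ℂ => (!₂[z.1 0, z.2] : C2) := by fun_prop
  -- The Cauchy integral over the circle in the second variable uses `γ` only on the cylinder; over
  -- the slice, Cauchy's formula identifies it with `γ`.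
  have ext : ∀ γ : C2 → C2 →L[ℂ] ℂ, DifferentiableOn ℂ γ T → ∃ Γ : C2 → C2 →L[ℂ] ℂ,
      DifferentiableOn ℂ Γ (bidisc p q ρ σ) ∧ ∀ y ∈ bidisc p' q ρ' σ, Γ y = γ y := by
    intro γ hγ
    refine ⟨fun y => (2 * Real.pi * Complex.I : ℂ)⁻¹ •
      ∮ ζ in C(q, σ), (ζ - y 1)⁻¹ • γ !₂[y 0, ζ], ?_, ?_⟩
    · suffices h : DifferentiableOn ℂ (fun y : C2 => ∮ ζ in C(q, σ), (ζ - y 1)⁻¹ • γ !₂[y 0, ζ])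
          (bidisc p q ρ σ) from h.const_smul (2 * Real.pi * Complex.I : ℂ)⁻¹
      have hne : ∀ y ∈ bidisc p q ρ σ, ∀ ζ ∈ Metric.sphere q σ, ζ - y 1 ≠ 0 := by
        intro y hy ζ hζ h0
        rw [sub_eq_zero] at h0
        have h1 := hy.2
        rw [← h0, Metric.mem_ball, Metric.mem_sphere.1 hζ] at h1
        exact h1.false
      refine differentiableOn_circleIntegral_of_param isOpen_bidisc hσ.le ?_ ?_
      · refine ContinuousOn.smul (f := fun z : C2 × ℂ => (z.2 - z.1 1)⁻¹)
          (g := fun z : C2 × ℂ => γ !₂[z.1 0, z.2]) ?_ ?_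
        · exact ContinuousOn.inv₀ (by fun_prop) fun z hz => hne z.1 hz.1 z.2 hz.2
        · exact hγ.continuousOn.comp hpair.continuousOn fun z hz =>
            hcyl _ (by simpa using hz.1.1) (by simpa using hz.2)
      · intro ζ hζ
        refine DifferentiableOn.smul (𝕜 := ℂ) (c := fun z : C2 => (ζ - z 1)⁻¹)
          (f := fun z : C2 => γ !₂[z 0, ζ]) ?_ ?_
        · exact DifferentiableOn.inv (by fun_prop) fun y hy => hne y hy ζ hζ
        · refine hγ.comp (f := fun z : C2 => (!₂[z 0, ζ] : C2)) ?_ fun z hz =>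
            hcyl _ (by simpa using hz.1) (by simpa using hζ)
          refine Differentiable.differentiableOn ?_
          rw [differentiable_euclidean]
          intro i
          fin_cases i
          · simp; fun_prop
          · simp
    · intro y hy
      have hd : DifferentiableOn ℂ (fun t : ℂ => γ !₂[y 0, t]) (Metric.closedBall q σ) := by
        refine hγ.comp (f := fun t : ℂ => (!₂[y 0, t] : C2)) ?_ fun t ht =>
          hslice _ (by simpa using hy.1) (by simpa using ht)
        refine Differentiable.differentiableOn ?_
        rw [differentiable_euclidean]
        intro i
        fin_cases i <;> simp
      change (2 * Real.pi * Complex.I : ℂ)⁻¹ • (∮ ζ in C(q, σ), (ζ - y 1)⁻¹ • γ !₂[y 0, ζ]) = γ y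
      rw [hd.circleIntegral_sub_inv_smul hy.2, inv_smul_smul₀ Complex.two_pi_I_ne_zero]
      congr 1
      ext i
      fin_cases i <;> simp
  obtain ⟨A, hA, hAα⟩ := ext α fun y hy => (hαβ y hy).left_diff.differentiableWithinAt
  obtain ⟨B, hB, hBβ⟩ := ext β fun y hy => (hαβ y hy).right_diff.differentiableWithinAt
  have hsubT : bidisc p' q ρ' σ ⊆ T := fun y hy =>
    hslice y hy.1 (Metric.ball_subset_closedBall hy.2)
  have hsub : bidisc p' q ρ' σ ⊆ bidisc p q ρ σ := fun y hy => ⟨hpp' hy.1, hy.2⟩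
  have hx : (!₂[p', q] : C2) ∈ bidisc p' q ρ' σ := ⟨by simpa using hρ', by simpa using hσ⟩
  have hev : ∀ᶠ y in 𝓝 (!₂[p', q] : C2), IsClosedDecompAt W A B y := by
    filter_upwards [isOpen_bidisc.mem_nhds hx] with y hy
    refine (hαβ y (hsubT hy)).congr ?_ ?_
    · filter_upwards [isOpen_bidisc.mem_nhds hy] with z hz using hAα z hz
    · filter_upwards [isOpen_bidisc.mem_nhds hy] with z hz using hBβ z hz
  -- Closedness is the vanishing of holomorphic functions, so it spreads from a neighbourhood of one
  -- point to the whole bidisc.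
  have closed : ∀ Γ : C2 → C2 →L[ℂ] ℂ, DifferentiableOn ℂ Γ (bidisc p q ρ σ) →
      (∀ᶠ y in 𝓝 (!₂[p', q] : C2), ∀ u v, fderiv ℂ Γ y u v = fderiv ℂ Γ y v u) →
      ∀ y ∈ bidisc p q ρ σ, ∀ u v, fderiv ℂ Γ y u v = fderiv ℂ Γ y v u := by
    intro Γ hΓ hΓc y hy u v
    rw [← sub_eq_zero]
    refine DifferentiableOn.eq_zero_of_convex_of_eventually_eq_zero
      (f := fun y => fderiv ℂ Γ y u v - fderiv ℂ Γ y v u) isOpen_bidisc convex_bidisc ?_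
      (hsub hx) (hΓc.mono fun z hz => sub_eq_zero.2 (hz u v)) hy
    have h1 := hΓ.fderiv_apply_of_isOpen isOpen_bidisc u
    have h2 := hΓ.fderiv_apply_of_isOpen isOpen_bidisc v
    exact (h1.clm_apply (differentiableOn_const v)).sub (h2.clm_apply (differentiableOn_const u))
  refine ⟨A, B, fun y hy => ⟨hA.differentiableAt (isOpen_bidisc.mem_nhds hy),
    hB.differentiableAt (isOpen_bidisc.mem_nhds hy),
    closed A hA (hev.mono fun _ h => h.left_closed) y hy,
    closed B hB (hev.mono fun _ h => h.right_closed) y hy, fun v => ?_⟩⟩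
  rw [← sub_eq_zero]
  refine DifferentiableOn.eq_zero_of_convex_of_eventually_eq_zero
    (f := fun y => A y v * B y v - W y v) isOpen_bidisc convex_bidisc ?_ (hsub hx)
    (hev.mono fun z hz => sub_eq_zero.2 (hz.mul_eq v)) hy
  exact ((hA.clm_apply (differentiableOn_const v)).mul
    (hB.clm_apply (differentiableOn_const v))).sub (hWd v)

/-- Closed decompositions at all points of a punctured ball yield one at the centre. -/
theorem exists_hasClosedDecomp_center {W : C2 → C2 → ℂ} {c : C2} {r : ℝ} (hr : 0 < r)
    (hWd : ∀ v, DifferentiableOn ℂ (fun y => W y v) (Metric.ball c r))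
    (hW : GenericallyNondegenerateOn W (Metric.ball c r))
    (hloc : ∀ x ∈ Metric.ball c r, x ≠ c → ∃ V, IsOpen V ∧ x ∈ V ∧ HasClosedDecomp W V) :
    ∃ V, IsOpen V ∧ c ∈ V ∧ HasClosedDecomp W V := by
  -- Small enough for all bidiscs below: the strictest requirement is `ρ + (ρ + ρ / 2) < r`.
  set ρ : ℝ := r / 5 with hρdef
  have hρ : 0 < ρ := by positivity
  have hpiece : ∀ {p q : ℂ} {s t : ℝ}, ‖p - c 0‖ + s + (‖q - c 1‖ + t) < r →
      c ∉ closedBidisc p q s t → HasClosedDecomp W (bidisc p q s t) ∧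
        GenericallyNondegenerateOn W (bidisc p q s t) := by
    intro p q s t hlt hc
    have hsub : closedBidisc p q s t ⊆ Metric.ball c r :=
      (closedBidisc_subset_closedBall c).trans (Metric.closedBall_subset_ball hlt)
    have hnd := hW.mono (bidisc_subset_closedBidisc.trans hsub)
    exact ⟨hasClosedDecomp_of_convex isOpen_bidisc convex_bidisc bidisc_subset_closedBidisc
      isCompact_closedBidisc hnd fun x hx => hloc x (hsub hx) fun h => hc (h ▸ hx), hnd⟩
  set a : ℂ := c 0 + (ρ / 2 : ℝ) with ha
  have hac : ‖a - c 0‖ = ρ / 2 := by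
    rw [ha, add_sub_cancel_left, Complex.norm_real, Real.norm_of_nonneg (by positivity)]
  -- The Hartogs figure. The slice misses `c` since `ρ / 4 < ρ / 2 = ‖a - c 0‖`, the others since `ρ
  -- / 2 < ρ = ‖ζ - c 1‖`. The slice has height `3 * ρ / 2 = ρ + ρ / 2` to cover the second
  -- coordinates of all the others.
  let U : Option (Metric.sphere (c 1) ρ) → Set C2 := fun o =>
    o.elim (bidisc a (c 1) (ρ / 4) (3 * ρ / 2)) fun ζ => bidisc (c 0) ζ ρ (ρ / 2)
  have hprop : ∀ i, HasClosedDecomp W (U i) ∧ GenericallyNondegenerateOn W (U i) := by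
    rintro (_ | ⟨ζ, hζ⟩)
    · refine hpiece ?_ fun h => ?_
      · rw [hac, sub_self, norm_zero]; linarith
      · have := mem_closedBall_iff_norm'.1 h.1
        rw [hac] at this
        linarith
    · rw [mem_sphere_iff_norm] at hζ
      refine hpiece ?_ fun h => ?_
      · change ‖c 0 - c 0‖ + ρ + (‖ζ - c 1‖ + ρ / 2) < r
        rw [hζ, sub_self, norm_zero]; linarith
      · have := mem_closedBall_iff_norm'.1 h.2
        change ‖ζ - c 1‖ ≤ ρ / 2 at this
        rw [hζ] at this
        linarith
  have hopen : ∀ i, IsOpen (U i) := by rintro (_ | ζ) <;> exact isOpen_bidisc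
  have hconv : ∀ i, Convex ℝ (U i) := by rintro (_ | ζ) <;> exact convex_bidisc
  have haρ : a ∈ Metric.ball (c 0) ρ := by rw [mem_ball_iff_norm, hac]; linarith
  -- Replacing the first coordinate by `a` stays in every cylinder bidisc containing `y` and enters
  -- the slice, so every overlap meets the slice.
  have hbase : ∀ ζ : Metric.sphere (c 1) ρ, ∀ y ∈ bidisc (c 0) ζ ρ (ρ / 2),
      (!₂[a, y 1] : C2) ∈ bidisc a (c 1) (ρ / 4) (3 * ρ / 2) ∩ bidisc (c 0) ζ ρ (ρ / 2) := by
    rintro ⟨ζ, hζ⟩ y hy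
    refine ⟨⟨by simpa using hρ, ?_⟩, by simpa using haρ, by simpa using hy.2⟩
    have h1 := Metric.mem_ball.1 hy.2
    have h2 := Metric.mem_sphere.1 hζ
    change dist (y 1) ζ < ρ / 2 at h1
    have h3 := dist_triangle (y 1) ζ (c 1)
    simp only [Metric.mem_ball]
    change dist (y 1) (c 1) < _
    linarith
  have hself : ∀ ζ : Metric.sphere (c 1) ρ, (!₂[c 0, (ζ : ℂ)] : C2) ∈
      bidisc (c 0) ζ ρ (ρ / 2) := fun ζ => ⟨by simpa using hρ, by simpa using hρ⟩
  have hcenter : (!₂[a, c 1] : C2) ∈ bidisc a (c 1) (ρ / 4) (3 * ρ / 2) :=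
    ⟨by simpa using hρ, by simpa using hρ⟩
  have hglue : HasClosedDecomp W (⋃ i, U i) := by
    refine hasClosedDecomp_iUnion none hopen hconv ?_ ?_ (fun i => (hprop i).2)
      fun i => (hprop i).1
    · rintro (_ | ζ)
      · exact ⟨_, hcenter⟩
      · exact ⟨_, hself ζ⟩
    · rintro (_ | ζ) (_ | ζ') h
      · exact ⟨_, hcenter, hcenter, hcenter⟩
      · have := hbase ζ' _ (hself ζ')
        exact ⟨_, this.1, this.1, this.2⟩
      · have := hbase ζ _ (hself ζ)
        exact ⟨_, this.1, this.2, this.1⟩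
      · obtain ⟨y, hy, hy'⟩ := h
        exact ⟨_, (hbase ζ y hy).1, (hbase ζ y hy).2, (hbase ζ' y hy').2⟩
  have hbig : bidisc (c 0) (c 1) ρ ρ ⊆ Metric.ball c r :=
    (bidisc_subset_closedBidisc.trans (closedBidisc_subset_closedBall c)).trans
      (Metric.closedBall_subset_ball (by simp only [sub_self, norm_zero]; linarith))
  refine ⟨bidisc (c 0) (c 1) ρ ρ, isOpen_bidisc, ⟨by simpa using hρ, by simpa using hρ⟩, ?_⟩
  refine hasClosedDecomp_bidisc_of_hartogsFigure (p' := a) (ρ' := ρ / 4) hρ (by positivity) ?_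
    (fun v => (hWd v).mono hbig) hglue ?_ ?_
  · refine Metric.ball_subset_ball' ?_
    rw [dist_eq_norm, hac]; linarith
  · intro y h0 h1
    exact Set.mem_iUnion.2 ⟨some ⟨y 1, h1⟩, h0, by simpa using hρ⟩
  · intro y h0 h1
    exact Set.mem_iUnion.2 ⟨none, h0, Metric.closedBall_subset_ball (by linarith) h1⟩

end Hartogs

/-! ### Passage between the surface and its charts. -/

section Charts

theorem pullback_differentiableAt {α : C2 → C2 →L[ℂ] ℂ} {φ : C2 → C2} {y : C2}
    (hα : DifferentiableAt ℂ α (φ y)) (hφ : ContDiffAt ℂ ω φ y) :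
    DifferentiableAt ℂ (fun z => (α (φ z)).comp (fderiv ℂ φ z)) y := by
  have h2 : DifferentiableAt ℂ (fderiv ℂ φ) y :=
    (hφ.fderiv_right (m := 1) le_top).differentiableAt (by simp)
  exact (hα.comp y (hφ.differentiableAt (by simp))).clm_comp h2

/-- The derivative of the pullback is `Dα(Dφ u)(Dφ v) + α(D²φ(u, v))`: the first term is symmetric
because `α` is closed, the second because second derivatives are. -/
theorem pullback_closed {α : C2 → C2 →L[ℂ] ℂ} {φ : C2 → C2} {y : C2}
    (hα : DifferentiableAt ℂ α (φ y)) (hφ : ContDiffAt ℂ ω φ y)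
    (hc : ∀ u v, fderiv ℂ α (φ y) u v = fderiv ℂ α (φ y) v u) (u v : C2) :
    fderiv ℂ (fun z => (α (φ z)).comp (fderiv ℂ φ z)) y u v =
      fderiv ℂ (fun z => (α (φ z)).comp (fderiv ℂ φ z)) y v u := by
  have h1 := hφ.differentiableAt (by simp)
  have h2 : DifferentiableAt ℂ (fderiv ℂ φ) y :=
    (hφ.fderiv_right (m := 1) le_top).differentiableAt (by simp)
  have h3 : HasFDerivAt (fun z => α (φ z)) ((fderiv ℂ α (φ y)).comp (fderiv ℂ φ y)) y :=
    hα.hasFDerivAt.comp y h1.hasFDerivAt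
  have key : ∀ u v, fderiv ℂ (fun z => (α (φ z)).comp (fderiv ℂ φ z)) y u v =
      fderiv ℂ α (φ y) (fderiv ℂ φ y u) (fderiv ℂ φ y v) +
        α (φ y) (fderiv ℂ (fderiv ℂ φ) y u v) := by
    intro u v
    rw [(h3.clm_comp h2.hasFDerivAt).fderiv]
    simp [add_comm]
  have hsymm := hφ.isSymmSndFDerivAt (by simp)
  rw [key, key, hc, hsymm u v]

variable {X : Type*} [TopologicalSpace X] [ChartedSpace C2 X]

theorem mdifferentiable_of_mem_holomorphicCharts [IsManifold 𝓘(ℂ, C2) ω X]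
    {e : OpenPartialHomeomorph X C2}
    (he : e ∈ holomorphicCharts X) : e.MDifferentiable 𝓘(ℂ, C2) 𝓘(ℂ, C2) :=
  ⟨(contMDiffOn_of_mem_maximalAtlas he).mdifferentiableOn (by simp),
    (contMDiffOn_symm_of_mem_maximalAtlas he).mdifferentiableOn (by simp)⟩

namespace SymmetricTwoDifferential

/-- The expression of `w` in the chart `e`. -/
noncomputable def inChart (w : SymmetricTwoDifferential X) (e : OpenPartialHomeomorph X C2) (y v : C2) : ℂ :=
  w.form (e.symm y) (mfderiv 𝓘(ℂ, C2) 𝓘(ℂ, C2) e.symm y v)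

theorem HasHolomorphicClosedDecompositionAt.inChart {w : SymmetricTwoDifferential X}
    {e : OpenPartialHomeomorph X C2} (he : e ∈ holomorphicCharts X) {y : C2} (hy : y ∈ e.target)
    (h : w.HasHolomorphicClosedDecompositionAt (e.symm y)) :
    ∃ V, IsOpen V ∧ y ∈ V ∧ HasClosedDecomp (w.inChart e) V := by
  obtain ⟨U, hU, hyU, μ₁, μ₂, h₁, h₂, hmul⟩ := h
  have hV : IsOpen (e.target ∩ e.symm ⁻¹' U) := e.isOpen_inter_preimage_symm hU
  refine ⟨_, hV, ⟨hy, hyU⟩, μ₁.inChart e, μ₂.inChart e, fun z hz =>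
    ⟨(h₁.holomorphic e he).differentiableAt (hV.mem_nhds hz),
      (h₂.holomorphic e he).differentiableAt (hV.mem_nhds hz), h₁.closed e he z hz,
      h₂.closed e he z hz, fun v => ?_⟩⟩
  simp only [SymmetricTwoDifferential.inChart]
  rw [hmul _ hz.2]
  rfl

variable [IsManifold 𝓘(ℂ, C2) ω X]

/-- In any other chart `e'` the transported form reads as the pullback of `α` under the holomorphic
transition map `e ∘ e'.symm`, so checking one chart suffices. -/
theorem isClosedHolomorphicOn_comp_chart {e : OpenPartialHomeomorph X C2}
    (he : e ∈ holomorphicCharts X) {α : C2 → C2 →L[ℂ] ℂ} {V : Set C2} (hV : IsOpen V)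
    (hα : ∀ y ∈ V, DifferentiableAt ℂ α y)
    (hc : ∀ y ∈ V, ∀ u v, fderiv ℂ α y u v = fderiv ℂ α y v u) :
    OneFormField.IsClosedHolomorphicOn
      (fun x : X => (α (e x)).comp (mfderiv 𝓘(ℂ, C2) 𝓘(ℂ, C2) e x)) (e.source ∩ e ⁻¹' V) := by
  have hU : IsOpen (e.source ∩ e ⁻¹' V) := e.isOpen_inter_preimage hV
  have key : ∀ e' ∈ holomorphicCharts X, ∀ y ∈ e'.target ∩ e'.symm ⁻¹' (e.source ∩ e ⁻¹' V),
      ContDiffAt ℂ ω (e ∘ e'.symm) y ∧ OneFormField.inChart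
        (fun x : X => (α (e x)).comp (mfderiv 𝓘(ℂ, C2) 𝓘(ℂ, C2) e x)) e' =ᶠ[𝓝 y]
          fun z => (α ((e ∘ e'.symm) z)).comp (fderiv ℂ (e ∘ e'.symm) z) := by
    intro e' he' y hy
    have hO := e'.isOpen_inter_preimage_symm hU
    refine ⟨?_, ?_⟩
    · rw [← contMDiffAt_iff_contDiffAt]
      exact (contMDiffAt_of_mem_maximalAtlas he hy.2.1).comp y
        (contMDiffAt_symm_of_mem_maximalAtlas he' hy.1)
    · filter_upwards [hO.mem_nhds hy] with z hz
      have h1 := (mdifferentiable_of_mem_holomorphicCharts he).mdifferentiableAt hz.2.1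
      have h2 := (mdifferentiable_of_mem_holomorphicCharts he').mdifferentiableAt_symm hz.1
      rw [← mfderiv_eq_fderiv, mfderiv_comp z h1 h2]
      rfl
  refine ⟨fun e' he' y hy => ?_, fun e' he' y hy u v => ?_⟩
  · obtain ⟨h1, h2⟩ := key e' he' y hy
    exact ((pullback_differentiableAt (hα _ hy.2.2) h1).congr_of_eventuallyEq
      h2).differentiableWithinAt
  · obtain ⟨h1, h2⟩ := key e' he' y hy
    rw [h2.fderiv_eq]
    exact pullback_closed (hα _ hy.2.2) h1 (hc _ hy.2.2) u v

theorem hasHolomorphicClosedDecompositionAt_of_inChart {w : SymmetricTwoDifferential X}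
    {e : OpenPartialHomeomorph X C2} (he : e ∈ holomorphicCharts X) {y : C2} (hy : y ∈ e.target)
    {V : Set C2} (hV : IsOpen V) (hyV : y ∈ V) (h : HasClosedDecomp (w.inChart e) V) :
    w.HasHolomorphicClosedDecompositionAt (e.symm y) := by
  obtain ⟨α, β, hαβ⟩ := h
  refine ⟨e.source ∩ e ⁻¹' V, e.isOpen_inter_preimage hV,
    ⟨e.map_target hy, by simpa [e.right_inv hy] using hyV⟩, _, _,
    isClosedHolomorphicOn_comp_chart he hV (fun z hz => (hαβ z hz).left_diff)
      (fun z hz => (hαβ z hz).left_closed),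
    isClosedHolomorphicOn_comp_chart he hV (fun z hz => (hαβ z hz).right_diff)
      (fun z hz => (hαβ z hz).right_closed), fun x hx => ?_⟩
  ext v
  have h1 := (hαβ (e x) hx.2).mul_eq (mfderiv 𝓘(ℂ, C2) 𝓘(ℂ, C2) e x v)
  have h2 := (mdifferentiable_of_mem_holomorphicCharts he).symm_comp_deriv hx.1
  have h3 : mfderiv 𝓘(ℂ, C2) 𝓘(ℂ, C2) e.symm (e x) (mfderiv 𝓘(ℂ, C2) 𝓘(ℂ, C2) e x v) = v :=
    DFunLike.congr_fun h2 v
  have h4 : w.inChart e (e x) (mfderiv 𝓘(ℂ, C2) 𝓘(ℂ, C2) e x v) = w.form x v := by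
    unfold SymmetricTwoDifferential.inChart
    have : ∀ x' (hx' : x' = x) (m : C2), m = v → w.form x' m = w.form x v := by
      rintro _ rfl _ rfl; rfl
    exact this _ (e.left_inv hx.1) _ h3
  rw [← h4, ← h1]
  rfl

/-- The dense rank-two locus meets the image of every nonempty open set, and pullback along the
surjective chart derivative keeps the two linear forms independent. -/
theorem HasRankTwo.genericallyNondegenerateOn_inChart {w : SymmetricTwoDifferential X}
    (hw : w.HasRankTwo) {e : OpenPartialHomeomorph X C2} (he : e ∈ holomorphicCharts X) :
    GenericallyNondegenerateOn (w.inChart e) e.target := by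
  intro V hVt hV hne
  obtain ⟨U, -, hd, hU⟩ := hw
  obtain ⟨_, ⟨y, hy, rfl⟩, hyU⟩ := hd.inter_open_nonempty _
    (e.isOpen_image_symm_of_subset_target hV hVt) (hne.image e.symm)
  refine ⟨y, hy, ?_⟩
  obtain ⟨a, b, hli, hab⟩ := hU _ hyU
  have hsurj : Function.Surjective (mfderiv 𝓘(ℂ, C2) 𝓘(ℂ, C2) e.symm y) :=
    (mdifferentiable_of_mem_holomorphicCharts he).symm.mfderiv_surjective (hVt hy)
  let M : C2 →L[ℂ] C2 := mfderiv 𝓘(ℂ, C2) 𝓘(ℂ, C2) e.symm y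
  let a' : C2 →ₗ[ℂ] ℂ := a
  let b' : C2 →ₗ[ℂ] ℂ := b
  let A : C2 →L[ℂ] ℂ := (LinearMap.toContinuousLinearMap a').comp M
  let B : C2 →L[ℂ] ℂ := (LinearMap.toContinuousLinearMap b').comp M
  have hW : w.inChart e y = fun v => A v * B v := by
    funext v
    unfold SymmetricTwoDifferential.inChart
    rw [hab]
    rfl
  rw [hW, quadDisc_mul]
  refine pow_ne_zero 2 fun h0 => ?_
  have hcomb : ∀ s t : ℂ, s • A + t • B = 0 → s = 0 ∧ t = 0 := by
    intro s t hst
    refine LinearIndependent.pair_iff.1 hli s t ?_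
    ext z
    obtain ⟨v, rfl⟩ := hsurj z
    exact DFunLike.congr_fun hst v
  set p : C2 := EuclideanSpace.single 0 1 with hp
  set q : C2 := EuclideanSpace.single 1 1 with hq
  -- If the wedge vanishes, `B p • A - A p • B` is zero, so `A p = 0`; with `q` likewise `A q = 0`.
  -- Then `A = 0`, against independence.
  have h1 := hcomb (B p) (-A p) (by
    refine C2.clm_ext ?_ ?_ <;> simp only [add_apply, smul_apply, smul_eq_mul, zero_apply] <;>
      unfold wedge at h0
    · ring
    · linear_combination -h0)
  have h2 := hcomb (B q) (-A q) (by
    refine C2.clm_ext ?_ ?_ <;> simp only [add_apply, smul_apply, smul_eq_mul, zero_apply] <;>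
      unfold wedge at h0
    · linear_combination h0
    · ring)
  have hA : A = 0 := C2.clm_ext (by simpa using h1.2) (by simpa using h2.2)
  exact one_ne_zero (hcomb 1 0 (by
    ext v
    change 1 * A v + 0 * B v = 0
    rw [hA]; simp)).1

theorem HasRankTwo.isOfFirstKindOn_ball {w : SymmetricTwoDifferential X} (hw : w.HasRankTwo)
    {e : OpenPartialHomeomorph X C2} (he : e ∈ holomorphicCharts X) {c : C2} {r : ℝ}
    (hball : Metric.ball c r ⊆ e.target)
    (h : w.IsOfFirstKindOn (e.symm '' (Metric.ball c r \ {c}))) :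
    w.IsOfFirstKindOn (e.symm '' Metric.ball c r) := by
  rintro _ ⟨y, hy, rfl⟩
  by_cases hyc : y = c
  · subst hyc
    obtain ⟨V, hV, hyV, hd⟩ := exists_hasClosedDecomp_center (W := w.inChart e)
      (Metric.pos_of_mem_ball hy)
      (fun v => (w.holomorphic e he v).mono hball)
      ((hw.genericallyNondegenerateOn_inChart he).mono hball)
      fun x hx hxy => (h _ ⟨x, ⟨hx, hxy⟩, rfl⟩).inChart he (hball hx)
    exact hasHolomorphicClosedDecompositionAt_of_inChart he (hball hy) hV hyV hd
  · exact h _ ⟨y, ⟨hy, hyc⟩, rfl⟩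

/-- Around a breakdown point that is not an accumulation point, some punctured coordinate ball is
free of breakdown; extension to its centre is a contradiction. -/
theorem HasRankTwo.preperfect_breakdownLocus {w : SymmetricTwoDifferential X}
    (hw : w.HasRankTwo) : Preperfect w.breakdownLocus := by
  intro x hx
  by_contra hacc
  rw [accPt_iff_nhds] at hacc
  push Not at hacc
  obtain ⟨U, hU, hUx⟩ := hacc
  set e := chartAt C2 x
  have he : e ∈ holomorphicCharts X := IsManifold.chart_mem_maximalAtlas x
  have hxe : x ∈ e.source := mem_chart_source C2 x
  have hpre : e.target ∩ e.symm ⁻¹' U ∈ 𝓝 (e x) := by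
    refine Filter.inter_mem (e.open_target.mem_nhds (e.map_source hxe)) ?_
    refine (e.continuousAt_symm (e.map_source hxe)).preimage_mem_nhds ?_
    rwa [e.left_inv hxe]
  obtain ⟨r, hr, hball⟩ := Metric.mem_nhds_iff.1 hpre
  have hfirst := hw.isOfFirstKindOn_ball he (fun y hy => (hball hy).1) (c := e x) (r := r) (by
    rintro _ ⟨y, ⟨hy, hyx⟩, rfl⟩
    by_contra hB
    refine hyx ?_
    rw [Set.mem_singleton_iff, ← hUx (e.symm y) ⟨(hball hy).2, hB⟩, e.right_inv (hball hy).1])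
  exact hx (by simpa [e.left_inv hxe] using hfirst _ ⟨e x, Metric.mem_ball_self hr, rfl⟩)

end SymmetricTwoDifferential

end Charts

/-- Let `w` be a symmetric 2-differential of rank 2 on a complex surface. If `w` is closed, its
breakdown locus has no isolated points (`Preperfect`: every point of the set is an accumulation
point of it). If `w` is of the 1st kind on a punctured coordinate ball, then it is of the 1st kind
on the whole ball. -/
theorem lemma2p2 {X : Type*} [TopologicalSpace X] [ChartedSpace C2 X]
    [IsManifold 𝓘(ℂ, C2) ω X] (w : SymmetricTwoDifferential X) (hrank : w.HasRankTwo) :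
    (w.Closed → Preperfect w.breakdownLocus) ∧
    (∀ e ∈ holomorphicCharts X, ∀ (c : C2) (r : ℝ), Metric.ball c r ⊆ e.target →
      w.IsOfFirstKindOn (e.symm '' (Metric.ball c r \ {c})) →
      w.IsOfFirstKindOn (e.symm '' Metric.ball c r)) :=
  ⟨fun _ => hrank.preperfect_breakdownLocus,
    fun _ he _ _ hball h => hrank.isOfFirstKindOn_ball he hball h⟩
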